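/- Let $G$ be a finite group and let $M\le N$ be nontrivial proper normal subgroups of $G$. Call $(G,N,M)$ a Frobenius triple if $C_G(x)\le N$ for every $1\ne x\in M$. Let $\mathrm{Irr}(N\mid M)$ denote the set of irreducible complex characters of $N$ whose kernel does not contain $M$, and let $\psi^G$ denote the character of $G$ induced from a character $\psi$ of $N$. (1) If $(G,N,M)$ is a Frobenius triple, then $\psi^G$ is irreducible for every $\psi\in\mathrm{Irr}(N\mid M)$. (2) If $\gcd(|G:N|,|M|)=1$, then $(G,N,M)$ is a Frobenius triple if and only if $\psi^G$ is irreducible for every $\psi\in\mathrm{Irr}(N\mid M)$. -/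

import Mathlib

/-- `(G, N, M)` is a Frobenius triple: `M ≤ N` are nontrivial proper normal subgroups of `G` and
`C_G(x) ≤ N` for every `1 ≠ x ∈ M`. -/
structure IsFrobeniusTriple {G : Type*} [Group G] (N M : Subgroup G) : Prop where
  normal_N : N.Normal
  normal_M : M.Normal
  N_ne_bot : N ≠ ⊥
  N_ne_top : N ≠ ⊤
  M_ne_bot : M ≠ ⊥
  M_ne_top : M ≠ ⊤
  M_le_N : M ≤ N
  centralizer_le : ∀ x ∈ M, x ≠ 1 → Subgroup.centralizer {x} ≤ N

/-- `χ ∈ Irr(G)`: `χ` is the character of an irreducible complex representation of finite degree.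
Up to isomorphism the underlying space is `ℂⁿ`. -/
def IsIrrChar {G : Type*} [Group G] (χ : G → ℂ) : Prop :=
  ∃ (n : ℕ) (ρ : Representation ℂ G (Fin n → ℂ)), ρ.IsIrreducible ∧ ρ.character = χ

/-- The kernel `{g | χ(g) = χ(1)}` of a character `χ`. -/
def charKer {G : Type*} [Group G] (χ : G → ℂ) : Set G :=
  {g | χ g = χ 1}

/-- `Irr(G ∣ M)`: the irreducible characters of `G` whose kernel does not contain `M`. -/
def irrNotOver {G : Type*} [Group G] (M : Subgroup G) : Set (G → ℂ) :=
  {χ | IsIrrChar χ ∧ ¬ (M : Set G) ⊆ charKer χ}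

open Classical in
/-- The induced class function
`ψ^G(g) = |H|⁻¹ ∑_{x ∈ G} ψ°(x g x⁻¹)`, where `ψ°` is `ψ` on `H` and `0` off `H`. -/
noncomputable def inducedChar {G : Type*} [Group G] [Fintype G] (H : Subgroup G) (ψ : H → ℂ) :
    G → ℂ :=
  fun g => (Nat.card H : ℂ)⁻¹ *
    ∑ x : G, if h : x * g * x⁻¹ ∈ H then ψ ⟨x * g * x⁻¹, h⟩ else 0

/-! Let ψ be the character of an irreducible representation ρ of `N`. By reciprocity, the norm of
ψ^G is |N|⁻¹ ∑_z dim Hom_N(ρ, ρ^z), where z runs over `G` and each z in `N` contributes 1. So ψ^G is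
irreducible once every z outside `N` contributes 0.

For a Frobenius triple, z outside `N` acts on `M` without nontrivial fixed points, so x ↦ z⁻¹xzx⁻¹
permutes `M`. An intertwiner T : ρ → ρ^z has the same trace against each of these commutators, while
∑_{m ∈ M} ρ(m) = 0; hence tr T = 0. Applying this to Tρ(n) and zn for all n in `N` forces T = 0
(`trace_eq_zero_of_mul_eq_conj_mul`, `IsIrreducible.eq_zero_of_trace_mul_eq_zero`).

Conversely, if all ψ^G are irreducible, an irreducible character of `G` nontrivial on `M` is itself
some ψ^G and so vanishes off `N`. Hence no character separates g from gx when g ∉ `N` and x ∈ `M`.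
If g centralizes x, replace g by a power of prime power order outside `N`; then gx is conjugate into
⟨g⟩, and coprimality gives x = 1. -/

/-- The trace of an endomorphism of a finite power is the sum of the traces of its diagonal
blocks. -/
theorem LinearMap.trace_pi_eq_sum {k ι V : Type*} [Field k] [AddCommGroup V] [Module k V]
    [FiniteDimensional k V] [Fintype ι] [DecidableEq ι] (f : (ι → V) →ₗ[k] (ι → V)) :
    LinearMap.trace k (ι → V) f =
      ∑ i, LinearMap.trace k V (LinearMap.proj i ∘ₗ f ∘ₗ LinearMap.single k (fun _ => V) i) := by
  have h : f = ∑ i, (f ∘ₗ LinearMap.single k (fun _ => V) i) ∘ₗ LinearMap.proj i := by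
    ext i v j
    rw [LinearMap.comp_apply, LinearMap.comp_apply, LinearMap.sum_apply, Finset.sum_apply,
      Finset.sum_eq_single i]
    · simp
    · intro c _ hc
      simp [Pi.single_eq_of_ne hc]
    · simp
  conv_lhs => rw [h]
  rw [map_sum]
  exact Finset.sum_congr rfl fun i _ => LinearMap.trace_comp_comm' _ _

namespace Representation

/-! ### Coinduced representations realize induced characters -/

section Coinduced

variable {G V : Type*} [Group G] [Fintype G] [AddCommGroup V] [Module ℂ V]
  (H : Subgroup G) (ρ : Representation ℂ H V)

/-- Translation by `x` on functions `G → V`, preceded by the projection onto the `H`-equivariant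
functions. -/
noncomputable def coindTranslate (x : G) : (G → V) →ₗ[ℂ] (G → V) :=
  open Classical in
  (Nat.card H : ℂ)⁻¹ • ∑ h : H,
    (ρ h⁻¹).compLeft G ∘ₗ LinearMap.funLeft ℂ V (fun g : G => (h : G) * g * x)

theorem coindTranslate_apply (x : G) (f : G → V) (g : G) :
    open Classical in
    coindTranslate H ρ x f g = (Nat.card H : ℂ)⁻¹ • ∑ h : H, ρ h⁻¹ (f ((h : G) * g * x)) := by
  simp [coindTranslate, Finset.sum_apply]

theorem coindTranslate_mem (x : G) (f : G → V) :
    coindTranslate H ρ x f ∈ coindV H.subtype ρ := by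
  classical
  intro a g
  simp only [coindTranslate_apply, map_smul, map_sum]
  congr 1
  refine Fintype.sum_equiv (Equiv.mulRight a) _ _ fun h => ?_
  rw [← Module.End.mul_apply, ← map_mul]
  simp [mul_assoc]

theorem coindTranslate_of_mem (x : G) {f : G → V} (hf : f ∈ coindV H.subtype ρ) (g : G) :
    coindTranslate H ρ x f g = f (g * x) := by
  classical
  have h1 : ∀ h : H, ρ h⁻¹ (f ((h : G) * g * x)) = f (g * x) := fun h => by
    have := hf h (g * x)
    rw [mul_assoc, ← H.subtype_apply h, this, ← Module.End.mul_apply, ← map_mul]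
    simp
  rw [coindTranslate_apply, Finset.sum_congr rfl fun h _ => h1 h]
  rw [Finset.sum_const, Finset.card_univ, Fintype.card_eq_nat_card, ← Nat.cast_smul_eq_nsmul ℂ,
    smul_smul, inv_mul_cancel₀ (by simp), one_smul]

/-- The character of a coinduced representation. -/
theorem character_coind [FiniteDimensional ℂ V] :
    (coind H.subtype ρ).character = inducedChar H ρ.character := by
  classical
  funext x
  -- `coindTranslate` has image in the coinduced space, so its trace on all of G → V equals the
  -- trace of the restriction and can be read off from diagonal blocks.
  have h1 : coind H.subtype ρ x = (coindTranslate H ρ x).restrict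
      (fun f _ => coindTranslate_mem H ρ x f) := by
    ext f g
    exact (coindTranslate_of_mem H ρ x f.2 g).symm
  rw [character, h1, LinearMap.trace_restrict_eq_of_forall_mem _ _ (coindTranslate_mem H ρ x),
    LinearMap.trace_pi_eq_sum, inducedChar, Finset.mul_sum]
  refine Finset.sum_congr rfl fun g _ => ?_
  have h2 : LinearMap.proj g ∘ₗ coindTranslate H ρ x ∘ₗ LinearMap.single ℂ (fun _ => V) g =
      (Nat.card H : ℂ)⁻¹ • ∑ h : H, if (h : G)⁻¹ = g * x * g⁻¹ then ρ h⁻¹ else 0 := by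
    ext v
    simp only [LinearMap.comp_apply, LinearMap.proj_apply, coindTranslate_apply,
      LinearMap.smul_apply, LinearMap.sum_apply, LinearMap.single_apply]
    congr 1
    refine Finset.sum_congr rfl fun h _ => ?_
    have h3 : (h : G) * g * x = g ↔ (h : G)⁻¹ = g * x * g⁻¹ := by
      rw [inv_eq_iff_mul_eq_one, ← mul_assoc, ← mul_assoc, mul_inv_eq_one]
    by_cases hh : (h : G) * g * x = g
    · rw [if_pos (h3.1 hh), hh, Pi.single_eq_same]
    · rw [if_neg (h3.not.1 hh), Pi.single_eq_of_ne hh]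
      simp
  rw [h2, map_smul, map_sum, smul_eq_mul]
  congr 1
  split_ifs with hm
  · rw [Finset.sum_eq_single ⟨g * x * g⁻¹, hm⟩⁻¹]
    · simp [character]
    · intro h _ hne
      rw [if_neg, map_zero]
      intro h'
      exact hne (inv_eq_iff_eq_inv.1 (Subtype.ext h'))
    · simp
  · refine Finset.sum_eq_zero fun h _ => ?_
    rw [if_neg, map_zero]
    intro h'
    exact hm (h' ▸ H.inv_mem h.2)

end Coinduced

/-! ### Criteria for irreducibility -/

section Irreducible

theorem _root_.Subrepresentation.isCompl_toSubmodule {k G V : Type*} [Field k] [Monoid G]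
    [AddCommGroup V] [Module k V] {ρ : Representation k G V} {p q : Subrepresentation ρ}
    (h : IsCompl p q) : IsCompl p.toSubmodule q.toSubmodule :=
  ⟨disjoint_iff.2 (congrArg Subrepresentation.toSubmodule h.inf_eq_bot),
    codisjoint_iff.2 (congrArg Subrepresentation.toSubmodule h.sup_eq_top)⟩

/-- The projection onto a subrepresentation along a complementary one. -/
noncomputable def _root_.Subrepresentation.projection {k G V : Type*} [Field k] [Monoid G]
    [AddCommGroup V] [Module k V] {ρ : Representation k G V} {p q : Subrepresentation ρ}
    (h : IsCompl p q) : IntertwiningMap ρ ρ where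
  toLinearMap := p.toSubmodule.projection q.toSubmodule (Subrepresentation.isCompl_toSubmodule h)
  isIntertwining' g := by
    have hpq := Subrepresentation.isCompl_toSubmodule h
    ext v
    obtain ⟨a, ha, b, hb, rfl⟩ : ∃ a ∈ p.toSubmodule, ∃ b ∈ q.toSubmodule, a + b = v :=
      Submodule.mem_sup.1 (hpq.sup_eq_top ▸ Submodule.mem_top)
    simp [Submodule.projection_apply_of_mem_left hpq ha,
      (Submodule.projection_apply_eq_zero_iff hpq).2 hb,
      Submodule.projection_apply_of_mem_left hpq (p.apply_mem_toSubmodule g ha),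
      (Submodule.projection_apply_eq_zero_iff hpq).2 (q.apply_mem_toSubmodule g hb)]

/-- The character of a direct sum. -/
theorem character_eq_add_of_isCompl {G V : Type*} [Group G] [AddCommGroup V] [Module ℂ V]
    [FiniteDimensional ℂ V] (ρ : Representation ℂ G V) {p q : Subrepresentation ρ}
    (h : IsCompl p q) (g : G) :
    ρ.character g = p.toRepresentation.character g + q.toRepresentation.character g := by
  have hpq := Subrepresentation.isCompl_toSubmodule h
  let e := Submodule.prodEquivOfIsCompl _ _ hpq
  have : ρ g = e.conj ((p.toRepresentation g).prodMap (q.toRepresentation g)) := by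
    ext v
    obtain ⟨w, rfl⟩ := e.surjective v
    simp [e, LinearEquiv.conj_apply, Subrepresentation.toRepresentation]
  rw [character, this, LinearMap.trace_conj', LinearMap.trace_prodMap']
  rfl

variable {G V : Type*} [Group G] [Fintype G] [AddCommGroup V] [Module ℂ V]
  (ρ : Representation ℂ G V)

/-- A complex representation of a finite group is irreducible if its only endomorphisms are the
scalars. -/
theorem isIrreducible_of_finrank_intertwiningMap_eq_one
    (h : Module.finrank ℂ (IntertwiningMap ρ ρ) = 1) : ρ.IsIrreducible := by
  have hid : IntertwiningMap.id ρ ≠ 0 := by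
    intro h0
    have : Subsingleton (IntertwiningMap ρ ρ) := ⟨fun a b => by
      ext v
      have hv : v = 0 := by simpa using DFunLike.congr_fun h0 v
      simp [hv]⟩
    simp [Module.finrank_zero_of_subsingleton] at h
  have hV : ∃ v : V, v ≠ 0 := by
    by_contra! hv
    exact hid (by ext v; simp [hv v])
  refine { exists_pair_ne := ⟨⊥, ⊤, fun hbt => ?_⟩, eq_bot_or_eq_top := fun p => ?_ }
  · obtain ⟨v, hv⟩ := hV
    have : v ∈ (⊥ : Subrepresentation ρ).toSubmodule := by rw [hbt]; exact Submodule.mem_top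
    exact hv ((Submodule.mem_bot ℂ).1 this)
  -- By Maschke `p` has a complement; the projection is a scalar c, so `p` is zero or everything
  -- according to whether c = 0.
  · obtain ⟨q, hq⟩ := exists_isCompl p
    have hpq := Subrepresentation.isCompl_toSubmodule hq
    obtain ⟨c, hc⟩ := (finrank_eq_one_iff_of_nonzero' _ hid).1 h (Subrepresentation.projection hq)
    have hc' : ∀ v, p.toSubmodule.projection q.toSubmodule hpq v = c • v := fun v =>
      (DFunLike.congr_fun hc v).symm
    by_cases h0 : c = 0
    · left
      refine Subrepresentation.toSubmodule_injective ((Submodule.eq_bot_iff _).2 fun v hv => ?_)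
      rw [← Submodule.projection_apply_of_mem_left hpq hv, hc', h0, zero_smul]
    · right
      refine Subrepresentation.toSubmodule_injective (Submodule.eq_top_iff'.2 fun v => ?_)
      have := Submodule.projection_apply_mem hpq v
      rw [hc'] at this
      exact (Submodule.smul_mem_iff _ h0).1 this

variable [FiniteDimensional ℂ V]

/-- The inner product of two characters is the dimension of a space of intertwining maps. -/
theorem sum_char_mul_char_inv_eq {W : Type*} [AddCommGroup W] [Module ℂ W]
    [FiniteDimensional ℂ W] (σ : Representation ℂ G W) :
    ∑ g : G, σ.character g * ρ.character g⁻¹ =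
      Nat.card G * Module.finrank ℂ (IntertwiningMap ρ σ) := by
  have : Invertible (Nat.card G : ℂ) := invertibleOfNonzero (by simp)
  rw [← card_inv_mul_sum_char_mul_char_eq_finrank, mul_inv_cancel_left₀ (by simp)]

theorem isIrreducible_iff_sum_char_mul_char_inv :
    ρ.IsIrreducible ↔ ∑ g : G, ρ.character g * ρ.character g⁻¹ = Nat.card G := by
  rw [sum_char_mul_char_inv_eq]
  constructor
  · intro h
    simp
  · intro h
    apply isIrreducible_of_finrank_intertwiningMap_eq_one
    have : (Module.finrank ℂ (IntertwiningMap ρ ρ) : ℂ) = 1 :=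
      mul_left_cancel₀ (b := (Module.finrank ℂ (IntertwiningMap ρ ρ) : ℂ))
        (a := (Nat.card G : ℂ)) (by simp) (by simpa using h)
    exact_mod_cast this

/-- The character of an irreducible representation on any finite-dimensional space is an
irreducible character. -/
theorem IsIrreducible.isIrrChar (h : ρ.IsIrreducible) : IsIrrChar ρ.character := by
  let e : V ≃ₗ[ℂ] (Fin (Module.finrank ℂ V) → ℂ) := (Module.finBasis ℂ V).equivFun
  let σ : Representation ℂ G (Fin (Module.finrank ℂ V) → ℂ) :=
    (e.conjRingEquiv : Module.End ℂ V →* _).comp ρ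
  have hχ : ρ.character = σ.character :=
    char_iso (Equiv.mk e fun g => by ext v; simp [σ])
  refine ⟨_, σ, ?_, hχ.symm⟩
  rw [isIrreducible_iff_sum_char_mul_char_inv, ← hχ]
  exact (isIrreducible_iff_sum_char_mul_char_inv ρ).1 h

/-- Two elements on which all irreducible characters agree are not separated by any character. -/
theorem character_eq_of_forall_isIrrChar {g h : G} (hgh : ∀ χ : G → ℂ, IsIrrChar χ → χ g = χ h) :
    ρ.character g = ρ.character h := by
  induction hn : Module.finrank ℂ V using Nat.strong_induction_on generalizing V with
  | _ n ih =>
    by_cases hirr : ρ.IsIrreducible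
    · exact hgh _ (hirr.isIrrChar ρ)
    -- The zero space is not irreducible, so it needs its own case.
    rcases subsingleton_or_nontrivial (Subrepresentation ρ) with hs | hs
    · have hV : Subsingleton V := by
        refine ⟨fun v w => ?_⟩
        have : ∀ u : V, u = 0 := fun u => by
          have hu : u ∈ (⊤ : Subrepresentation ρ).toSubmodule := Submodule.mem_top
          rw [Subsingleton.elim (⊤ : Subrepresentation ρ) ⊥] at hu
          exact (Submodule.mem_bot ℂ).1 hu
        rw [this v, this w]
      simp only [character]
      rw [Subsingleton.elim (ρ g) (ρ h)]
    · obtain ⟨p, hp, hp'⟩ : ∃ p : Subrepresentation ρ, p ≠ ⊥ ∧ p ≠ ⊤ := by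
        by_contra! hcon
        exact hirr ⟨fun p => or_iff_not_imp_left.2 (hcon p)⟩
      obtain ⟨q, hq⟩ := exists_isCompl p
      have hlt : ∀ r : Subrepresentation ρ, r ≠ ⊤ → Module.finrank ℂ r.toSubmodule < n :=
        fun r hr => hn ▸ Submodule.finrank_lt fun h' =>
          hr (Subrepresentation.toSubmodule_injective h')
      have hq' : q ≠ ⊤ := fun h' => hp (by simpa [h'] using hq.inf_eq_bot)
      rw [character_eq_add_of_isCompl ρ hq, character_eq_add_of_isCompl ρ hq,
        ih _ (hlt p hp') _ rfl, ih _ (hlt q hq') _ rfl]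

end Irreducible

end Representation

namespace Representation

/-! ### Schur averaging and the trace form -/

section Schur

variable {G V : Type*} [Group G] [Fintype G] [AddCommGroup V] [Module ℂ V]
  [FiniteDimensional ℂ V] (ρ : Representation ℂ G V)

/-- Averaging an endomorphism over an irreducible representation yields a scalar. -/
theorem IsIrreducible.exists_sum_conj_eq_smul (hρ : ρ.IsIrreducible) (A : Module.End ℂ V) :
    ∃ c : ℂ, ∑ g : G, ρ g⁻¹ * A * ρ g = c • 1 ∧
      c * Module.finrank ℂ V = Nat.card G * LinearMap.trace ℂ V A := by
  let S : IntertwiningMap ρ ρ := ⟨∑ g : G, ρ g⁻¹ * A * ρ g, fun h => by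
    change (∑ g : G, ρ g⁻¹ * A * ρ g) * ρ h = ρ h * (∑ g : G, ρ g⁻¹ * A * ρ g)
    rw [Finset.sum_mul, Finset.mul_sum]
    refine Fintype.sum_equiv (Equiv.mulRight h) _ _ fun g => ?_
    simp only [Equiv.coe_mulRight, mul_inv_rev, map_mul]
    simp only [mul_assoc]
    rw [← mul_assoc (ρ h), ← map_mul ρ h, mul_inv_cancel, map_one, one_mul]⟩
  obtain ⟨c, hc⟩ :=
    (IsIrreducible.algebraMap_intertwiningMap_bijective_of_isAlgClosed (ρ := ρ)).2 S
  have hS : ∑ g : G, ρ g⁻¹ * A * ρ g = c • 1 :=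
    (congrArg IntertwiningMap.toLinearMap hc).symm
  refine ⟨c, hS, ?_⟩
  have ht := congrArg (LinearMap.trace ℂ V) hS
  rw [map_sum, map_smul, LinearMap.trace_one, smul_eq_mul] at ht
  rw [← ht, Finset.sum_congr rfl fun g _ => ?_]
  · rw [Finset.sum_const, Finset.card_univ, Fintype.card_eq_nat_card, nsmul_eq_mul]
  · rw [LinearMap.trace_mul_comm, ← mul_assoc, ← map_mul, mul_inv_cancel, map_one, one_mul]

/-- An endomorphism that is orthogonal to an irreducible representation in the trace form is
zero. -/
theorem IsIrreducible.eq_zero_of_trace_mul_eq_zero (hρ : ρ.IsIrreducible) (T : Module.End ℂ V)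
    (hT : ∀ g, LinearMap.trace ℂ V (T * ρ g) = 0) : T = 0 := by
  let b := Module.finBasis ℂ V
  ext v
  -- Average the rank one maps w ↦ bᵢ*(T w) v to scalars cᵢ. Evaluating at bᵢ and summing gives ∑ cᵢ
  -- bᵢ = ∑_g tr(Tρ(g)) ρ(g⁻¹)v = 0, so each cᵢ, and with it the trace bᵢ*(T v), vanishes.
  choose c hc hc' using fun i => hρ.exists_sum_conj_eq_smul ρ (((b.coord i).comp T).smulRight v)
  have h0 : ∑ i, c i • b i = 0 := by
    have h1 : ∀ i, c i • b i = ∑ g : G, b.coord i (T (ρ g (b i))) • ρ g⁻¹ v := fun i => by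
      have := LinearMap.congr_fun (hc i) (b i)
      simpa [LinearMap.sum_apply] using this.symm
    rw [Finset.sum_congr rfl fun i _ => h1 i, Finset.sum_comm]
    refine Finset.sum_eq_zero fun g _ => ?_
    rw [← Finset.sum_smul]
    have h2 := hT g
    rw [LinearMap.trace_eq_matrix_trace ℂ b, Matrix.trace] at h2
    simp only [Matrix.diag_apply, LinearMap.toMatrix_apply, Module.End.mul_apply] at h2
    simp only [Module.Basis.coord_apply, h2, zero_smul]
  have h3 : ∀ i, c i = 0 := Fintype.linearIndependent_iff.1 b.linearIndependent c h0
  refine b.ext_elem fun i => ?_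
  have h4 := hc' i
  rw [h3 i, zero_mul, LinearMap.trace_smulRight] at h4
  simpa using h4

end Schur

/-! ### Restriction to a subgroup: fixed vectors and kernels -/

section NormalSubgroup

variable {G V : Type*} [Group G] [AddCommGroup V] [Module ℂ V]
  (ρ : Representation ℂ G V) (M : Subgroup G)

/-- A normal subgroup that acts nontrivially on an irreducible representation has no nonzero fixed
vector. -/
theorem IsIrreducible.invariants_eq_bot [M.Normal] (hρ : ρ.IsIrreducible)
    (hM : ∃ m ∈ M, ρ m ≠ 1) : invariants (ρ.comp M.subtype) = ⊥ := by
  let p : Subrepresentation ρ :=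
    ⟨invariants (ρ.comp M.subtype), fun g _ hv => le_comap_invariants ρ M g hv⟩
  rcases hρ.eq_bot_or_eq_top p with hp | hp
  · exact congrArg Subrepresentation.toSubmodule hp
  · obtain ⟨m, hm, hne⟩ := hM
    refine absurd (LinearMap.ext fun v => ?_) hne
    have hv : v ∈ p.toSubmodule := by rw [hp]; exact Submodule.mem_top
    exact hv ⟨m, hm⟩

theorem IsIrreducible.sum_eq_zero [M.Normal] [Fintype M] (hρ : ρ.IsIrreducible)
    (hM : ∃ m ∈ M, ρ m ≠ 1) : ∑ m : M, ρ m = 0 := by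
  ext v
  have : (∑ m : M, ρ m) v ∈ invariants (ρ.comp M.subtype) := fun a => by
    simp only [LinearMap.sum_apply, map_sum]
    refine Fintype.sum_equiv (Equiv.mulLeft a) _ _ fun m => ?_
    simp
  rw [hρ.invariants_eq_bot ρ M hM] at this
  exact (Submodule.mem_bot ℂ).1 this

/-- A subgroup on which the character is constant acts trivially. -/
theorem apply_eq_one_of_subset_charKer [Finite M] [FiniteDimensional ℂ V]
    (h : (M : Set G) ⊆ charKer ρ.character) {m : G} (hm : m ∈ M) : ρ m = 1 := by
  have := Fintype.ofFinite M
  have : Invertible (Nat.card M : ℂ) := invertibleOfNonzero (by simp)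
  -- The average of the character over `M` is the dimension of the fixed space; a constant character
  -- makes this all of `V`.
  have h1 := card_inv_mul_sum_char_eq_finrank (ρ.comp M.subtype)
  have h2 : ∀ a : M, character (ρ.comp M.subtype) a = Module.finrank ℂ V := fun a => by
    rw [← char_one ρ]
    exact h a.2
  rw [Finset.sum_congr rfl fun a _ => h2 a, Finset.sum_const, Finset.card_univ,
    Fintype.card_eq_nat_card, nsmul_eq_mul, inv_mul_cancel_left₀ (by simp)] at h1
  have h3 : invariants (ρ.comp M.subtype) = ⊤ :=
    Submodule.eq_top_of_finrank_eq (by exact_mod_cast h1.symm)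
  ext v
  have hv : v ∈ invariants (ρ.comp M.subtype) := h3 ▸ Submodule.mem_top
  exact hv ⟨m, hm⟩

end NormalSubgroup

end Representation

/-! ### Induced class functions and reciprocity -/

section InducedChar

variable {G : Type*} [Group G] [Fintype G] (H : Subgroup G)

/-- Frobenius reciprocity for class functions. -/
theorem card_mul_sum_mul_inducedChar [Fintype H] (ψ : H → ℂ) {χ : G → ℂ}
    (hχ : ∀ x g, χ (x * g * x⁻¹) = χ g) :
    Nat.card H * ∑ g, χ g * inducedChar H ψ g = Nat.card G * ∑ h : H, χ h * ψ h := by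
  classical
  have h1 : ∀ x : G, ∑ g, χ g * (if h : x * g * x⁻¹ ∈ H then ψ ⟨x * g * x⁻¹, h⟩ else 0) =
      ∑ h : H, χ h * ψ h := fun x => by
    have e1 : ∑ g, χ g * (if h : x * g * x⁻¹ ∈ H then ψ ⟨x * g * x⁻¹, h⟩ else 0) =
        ∑ g, χ g * (if h : g ∈ H then ψ ⟨g, h⟩ else 0) :=
      Fintype.sum_equiv (MulAut.conj x).toEquiv _ _ fun g => by
        change _ = χ (x * g * x⁻¹) * _
        rw [hχ]
        rfl
    rw [e1]
    symm
    refine Fintype.sum_of_injective _ Subtype.val_injective _ _ (fun g hg => ?_) fun h => ?_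
    · rw [dif_neg (by simpa using hg), mul_zero]
    · rw [dif_pos h.2]
  have h2 : ∀ g, χ g * inducedChar H ψ g = (Nat.card H : ℂ)⁻¹ *
      ∑ x : G, χ g * (if h : x * g * x⁻¹ ∈ H then ψ ⟨x * g * x⁻¹, h⟩ else 0) := fun g => by
    rw [inducedChar, ← Finset.mul_sum]
    ring
  rw [Finset.sum_congr rfl fun g _ => h2 g, ← Finset.mul_sum, mul_inv_cancel_left₀ (by simp),
    Finset.sum_comm, Finset.sum_congr rfl fun x _ => h1 x, Finset.sum_const, Finset.card_univ,
    Fintype.card_eq_nat_card, nsmul_eq_mul]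

theorem inducedChar_conj (ψ : H → ℂ) (y g : G) :
    inducedChar H ψ (y * g * y⁻¹) = inducedChar H ψ g := by
  classical
  rw [inducedChar, inducedChar]
  congr 1
  refine Fintype.sum_equiv (Equiv.mulRight y) _ _ fun x => ?_
  have : x * (y * g * y⁻¹) * x⁻¹ = x * y * g * (x * y)⁻¹ := by group
  simp [this]

variable (N : Subgroup G) [N.Normal]

theorem inducedChar_eq_zero_of_notMem (ψ : N → ℂ) {g : G} (hg : g ∉ N) :
    inducedChar N ψ g = 0 := by
  rw [inducedChar, Finset.sum_eq_zero, mul_zero]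
  intro x _
  rw [dif_neg]
  rwa [‹N.Normal›.mem_comm_iff, inv_mul_cancel_left]

theorem inducedChar_coe (ψ : N → ℂ) (n : N) :
    inducedChar N ψ n = (Nat.card N : ℂ)⁻¹ * ∑ x : G, ψ (MulAut.conjNormal x n) := by
  rw [inducedChar]
  congr 1
  refine Finset.sum_congr rfl fun x _ => ?_
  rw [dif_pos (‹N.Normal›.conj_mem _ n.2 x)]
  rfl

end InducedChar

open Representation

/-! ### Frobenius triples give irreducible induced characters -/

section Frobenius

variable {G V : Type*} [Group G] [Fintype G] [AddCommGroup V] [Module ℂ V]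
  {N M : Subgroup G} [M.Normal]

/-- If no element of `M` other than `1` commutes with `z`, then `x ↦ z⁻¹xzx⁻¹` permutes `M`. -/
theorem bijective_commutator_of_centralizer (hMN : M ≤ N) {z : G}
    (hz : ∀ x ∈ M, z * x = x * z → x = 1) :
    ∃ φ : M.subgroupOf N → M.subgroupOf N, Function.Bijective φ ∧
      ∀ x, ((φ x : N) : G) = z⁻¹ * (x : N) * z * ((x : N) : G)⁻¹ := by
  have hmem : ∀ x : M.subgroupOf N, z⁻¹ * ((x : N) : G) * z * ((x : N) : G)⁻¹ ∈ M := fun x =>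
    M.mul_mem (‹M.Normal›.conj_mem' _ (Subgroup.mem_subgroupOf.1 x.2) z)
      (M.inv_mem (Subgroup.mem_subgroupOf.1 x.2))
  refine ⟨fun x => ⟨⟨_, hMN (hmem x)⟩, Subgroup.mem_subgroupOf.2 (hmem x)⟩, ?_, fun x => rfl⟩
  refine Finite.injective_iff_bijective.1 fun x y hxy => ?_
  have h1 : z⁻¹ * ((x : N) : G) * z * ((x : N) : G)⁻¹ =
      z⁻¹ * ((y : N) : G) * z * ((y : N) : G)⁻¹ :=
    congrArg (fun a : M.subgroupOf N => ((a : N) : G)) hxy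
  -- Equal images of x and y mean that y⁻¹x commutes with z.
  have h2 := hz (((y : N) : G)⁻¹ * ((x : N) : G))
    (M.mul_mem (M.inv_mem (Subgroup.mem_subgroupOf.1 y.2)) (Subgroup.mem_subgroupOf.1 x.2)) (by
      generalize ((x : N) : G) = a at h1
      generalize ((y : N) : G) = b at h1
      have h3 : a * z * a⁻¹ = b * z * b⁻¹ := by
        simpa [mul_assoc] using h1
      calc z * (b⁻¹ * a) = b⁻¹ * (b * z * b⁻¹) * a := by group
        _ = b⁻¹ * (a * z * a⁻¹) * a := by rw [h3]
        _ = b⁻¹ * a * z := by group)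
  exact Subtype.ext (Subtype.ext (inv_mul_eq_one.1 h2).symm)

variable [N.Normal]

/-- An operator intertwining an irreducible representation of `N` on which `M` acts nontrivially
with its conjugate by an element acting on `M` without fixed points has trace zero. -/
theorem trace_eq_zero_of_mul_eq_conj_mul (hMN : M ≤ N) {ρ : Representation ℂ N V}
    (hρ : ρ.IsIrreducible) (hM : ∃ m ∈ M.subgroupOf N, ρ m ≠ 1) {z : G}
    (hz : ∀ x ∈ M, z * x = x * z → x = 1) {T : Module.End ℂ V}
    (hT : ∀ n, T * ρ n = ρ (MulAut.conjNormal z n) * T) : LinearMap.trace ℂ V T = 0 := by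
  classical
  obtain ⟨φ, hφ, hφ'⟩ := bijective_commutator_of_centralizer hMN hz
  -- Moving ρ(z⁻¹xz) across T turns it into ρ(x), which cancels ρ(x⁻¹) by cyclicity of the trace.
  have h1 : ∀ x : M.subgroupOf N, LinearMap.trace ℂ V (T * ρ (φ x)) = LinearMap.trace ℂ V T := by
    intro x
    have h2 : (φ x : N) = (MulAut.conjNormal z).symm x * (x : N)⁻¹ := by
      ext
      rw [hφ' x]
      simp
    rw [h2, map_mul ρ, ← mul_assoc, hT, MulEquiv.apply_symm_apply, LinearMap.trace_mul_comm,
      ← mul_assoc, ← map_mul ρ, inv_mul_cancel, map_one, one_mul]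
  have h3 : ∑ x : M.subgroupOf N, LinearMap.trace ℂ V (T * ρ (φ x)) = 0 := by
    rw [hφ.sum_comp fun m : M.subgroupOf N => LinearMap.trace ℂ V (T * ρ m), ← map_sum,
      ← Finset.mul_sum, hρ.sum_eq_zero ρ _ hM, mul_zero, map_zero]
  rw [Finset.sum_congr rfl fun x _ => h1 x, Finset.sum_const, nsmul_eq_mul] at h3
  exact (mul_eq_zero.1 h3).resolve_left (by simp [Finset.card_univ])

/-- The conjugate of a representation of a normal subgroup. -/
noncomputable abbrev conjRep (ρ : Representation ℂ N V) (z : G) : Representation ℂ N V :=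
  ρ.comp (MulAut.conjNormal z : MulAut N).toMonoidHom

variable [FiniteDimensional ℂ V]

/-- For an intertwiner f, the operator fρ(n) intertwines ρ with its conjugate by zn, which again
lies outside `N`. So every fρ(n) has trace zero, and f = 0. -/
theorem finrank_intertwiningMap_conjRep_eq_zero (hMN : M ≤ N) {ρ : Representation ℂ N V}
    (hρ : ρ.IsIrreducible) (hM : ∃ m ∈ M.subgroupOf N, ρ m ≠ 1)
    (hC : ∀ x ∈ M, x ≠ 1 → Subgroup.centralizer {x} ≤ N) {z : G} (hz : z ∉ N) :
    Module.finrank ℂ (IntertwiningMap ρ (conjRep ρ z)) = 0 := by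
  classical
  have : Subsingleton (IntertwiningMap ρ (conjRep ρ z)) := by
    refine subsingleton_of_forall_eq 0 fun f => IntertwiningMap.ext ?_
    have hf : ∀ n, f.toLinearMap * ρ n = ρ (MulAut.conjNormal z n) * f.toLinearMap := fun n =>
      f.isIntertwining' n
    refine hρ.eq_zero_of_trace_mul_eq_zero ρ _ fun n => ?_
    refine trace_eq_zero_of_mul_eq_conj_mul (z := z * n) hMN hρ hM (fun x hx hxz => ?_) fun k => ?_
    · by_contra hne
      have h1 : z * n ∈ N := hC x hx hne (Subgroup.mem_centralizer_singleton_iff.2 hxz)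
      exact hz ((N.mul_mem_cancel_right n.2).1 h1)
    · have h2 : MulAut.conjNormal (z * n) k * MulAut.conjNormal z n =
          MulAut.conjNormal z (n * k) := by
        rw [map_mul MulAut.conjNormal, MulAut.mul_apply, ← map_mul, MulAut.conjNormal_val,
          MulAut.conj_apply, inv_mul_cancel_right]
      rw [mul_assoc, ← map_mul, hf, hf, ← mul_assoc, ← map_mul, h2]
  exact Module.finrank_zero_of_subsingleton

theorem finrank_intertwiningMap_conjRep_coe {ρ : Representation ℂ N V} (hρ : ρ.IsIrreducible)
    (n : N) : Module.finrank ℂ (IntertwiningMap ρ (conjRep ρ (n : G))) = 1 := by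
  classical
  have h := sum_char_mul_char_inv_eq ρ (conjRep ρ (n : G))
  have h1 : (conjRep ρ (n : G)).character = ρ.character := by
    funext k
    rw [← char_conj ρ k n]
    simp [character, MulAut.conjNormal_val]
  rw [h1, (isIrreducible_iff_sum_char_mul_char_inv ρ).1 hρ] at h
  have h2 : (Module.finrank ℂ (IntertwiningMap ρ (conjRep ρ (n : G))) : ℂ) = 1 :=
    mul_left_cancel₀ (a := (Nat.card N : ℂ)) (by simp) (by simpa using h.symm)
  exact_mod_cast h2

/-- The norm of the character induced from a normal subgroup. -/
theorem card_mul_sum_inducedChar_mul_inducedChar_inv (ρ : Representation ℂ N V) :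
    Nat.card N * ∑ g, inducedChar N ρ.character g * inducedChar N ρ.character g⁻¹ =
      Nat.card G * ∑ z : G, (Module.finrank ℂ (IntertwiningMap ρ (conjRep ρ z)) : ℂ) := by
  classical
  have h1 : ∑ g, inducedChar N ρ.character g * inducedChar N ρ.character g⁻¹ =
      ∑ g, inducedChar N ρ.character g⁻¹ * inducedChar N ρ.character g :=
    Finset.sum_congr rfl fun g _ => mul_comm _ _
  rw [h1, card_mul_sum_mul_inducedChar N ρ.character
    (χ := fun g => inducedChar N ρ.character g⁻¹) fun x g => by
      rw [mul_inv_rev, mul_inv_rev, inv_inv, ← mul_assoc, inducedChar_conj]]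
  congr 1
  -- On the normal subgroup, the induced character is |N|⁻¹ times the sum of the conjugates of ψ.
  have h2 : ∀ h : N, inducedChar N ρ.character (h : G)⁻¹ * ρ.character h =
      (Nat.card N : ℂ)⁻¹ * ∑ z : G, (conjRep ρ z).character h⁻¹ * ρ.character h := fun h => by
    rw [← Subgroup.coe_inv, inducedChar_coe, mul_assoc, Finset.sum_mul]
    rfl
  rw [Finset.sum_congr rfl fun h _ => h2 h, ← Finset.mul_sum, Finset.sum_comm, Finset.mul_sum]
  refine Finset.sum_congr rfl fun z _ => ?_
  have h3 := sum_char_mul_char_inv_eq ρ (conjRep ρ z)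
  rw [inv_mul_eq_iff_eq_mul₀ (by simp), ← h3]
  exact Fintype.sum_equiv (Equiv.inv N) _ _ fun h => by simp

theorem isIrrChar_inducedChar (hMN : M ≤ N)
    (hC : ∀ x ∈ M, x ≠ 1 → Subgroup.centralizer {x} ≤ N) {ψ : N → ℂ}
    (hψ : ψ ∈ irrNotOver (M.subgroupOf N)) : IsIrrChar (inducedChar N ψ) := by
  classical
  obtain ⟨⟨n, ρ, hρ, rfl⟩, hker⟩ := hψ
  have hM : ∃ m ∈ M.subgroupOf N, ρ m ≠ 1 := by
    by_contra! hcon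
    exact hker fun m hm => by simp [charKer, character, hcon m hm]
  rw [← character_coind]
  refine IsIrreducible.isIrrChar _ ?_
  rw [isIrreducible_iff_sum_char_mul_char_inv, character_coind]
  have h1 := card_mul_sum_inducedChar_mul_inducedChar_inv ρ
  have h2 : ∑ z : G, (Module.finrank ℂ (IntertwiningMap ρ (conjRep ρ z)) : ℂ) = Nat.card N := by
    have h3 := Fintype.sum_of_injective (Subtype.val : N → G) Subtype.val_injective
      (fun _ => (1 : ℂ)) (fun z => (Module.finrank ℂ (IntertwiningMap ρ (conjRep ρ z)) : ℂ))
      (fun z hz => by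
        rw [finrank_intertwiningMap_conjRep_eq_zero hMN hρ hM hC (by simpa using hz),
          Nat.cast_zero])
      (fun z => by rw [finrank_intertwiningMap_conjRep_coe hρ, Nat.cast_one])
    rw [← h3]
    simp
  rw [h2, mul_comm (Nat.card G : ℂ)] at h1
  exact mul_left_cancel₀ (by simp) h1

end Frobenius

/-! ### The converse under coprimality -/

section Converse

variable {G : Type*} [Group G] [Fintype G] {N M : Subgroup G} [N.Normal] [M.Normal]

/-- A nonzero finite-dimensional representation contains an irreducible one. -/
theorem Representation.exists_isIrreducible_toRepresentation {G V : Type*} [Group G]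
    [AddCommGroup V] [Module ℂ V] [FiniteDimensional ℂ V] [Nontrivial V]
    (ρ : Representation ℂ G V) : ∃ p : Subrepresentation ρ, p.toRepresentation.IsIrreducible := by
  have htop : (⊤ : Subrepresentation ρ) ≠ ⊥ := fun h =>
    top_ne_bot (α := Submodule ℂ V) (congrArg Subrepresentation.toSubmodule h)
  obtain ⟨p, hp, hmin⟩ := WellFounded.has_min
    (InvImage.wf (fun p : Subrepresentation ρ => Module.finrank ℂ p.toSubmodule) Nat.lt_wfRel.wf)
    {p | p ≠ ⊥} ⟨⊤, htop⟩
  refine ⟨p, { exists_pair_ne := ⟨⊥, ⊤, fun h => hp ?_⟩, eq_bot_or_eq_top := fun q => ?_ }⟩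
  · have h' : (⊥ : Submodule ℂ p.toSubmodule) = ⊤ := congrArg Subrepresentation.toSubmodule h
    exact Subrepresentation.toSubmodule_injective (Submodule.subsingleton_iff_eq_bot.1
      ((Submodule.subsingleton_iff ℂ).1 (subsingleton_of_bot_eq_top h')))
  · refine or_iff_not_imp_left.2 fun hq => ?_
    let q' : Subrepresentation ρ := ⟨q.toSubmodule.map p.toSubmodule.subtype, fun g v hv => by
      obtain ⟨w, hw, rfl⟩ := hv
      exact ⟨_, q.apply_mem_toSubmodule g hw, rfl⟩⟩
    have hq' : q' ≠ ⊥ := fun h => hq (Subrepresentation.toSubmodule_injective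
      (Submodule.map_injective_of_injective p.toSubmodule.injective_subtype
        ((congrArg Subrepresentation.toSubmodule h).trans (Submodule.map_bot _).symm)))
    have h1 : Module.finrank ℂ p.toSubmodule ≤ Module.finrank ℂ q'.toSubmodule :=
      not_lt.1 (hmin q' hq')
    rw [Submodule.finrank_map_subtype_eq] at h1
    exact Subrepresentation.toSubmodule_injective
      (Submodule.eq_top_of_finrank_eq (le_antisymm (Submodule.finrank_le _) h1))

/-- If all characters induced from `Irr(N ∣ M)` are irreducible, then an irreducible representation
of `G` on which `M` acts nontrivially has a character that vanishes off `N`. -/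
theorem character_eq_zero_of_notMem {V : Type*} [AddCommGroup V] [Module ℂ V]
    [FiniteDimensional ℂ V] (hMN : M ≤ N)
    (hind : ∀ ψ ∈ irrNotOver (M.subgroupOf N), IsIrrChar (inducedChar N ψ))
    (σ : Representation ℂ G V) (hσ : σ.IsIrreducible) (hM : ∃ m ∈ M, σ m ≠ 1) {g : G}
    (hg : g ∉ N) : σ.character g = 0 := by
  classical
  have : Nontrivial V := by
    obtain ⟨m, _, hm⟩ := hM
    by_contra hV
    rw [not_nontrivial_iff_subsingleton] at hV
    exact hm (Subsingleton.elim _ _)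
  let τ : Representation ℂ N V := σ.comp N.subtype
  obtain ⟨p, hp⟩ := τ.exists_isIrreducible_toRepresentation
  have hψ : p.toRepresentation.character ∈ irrNotOver (M.subgroupOf N) := by
    refine ⟨hp.isIrrChar _, fun hker => ?_⟩
    obtain ⟨v, hv⟩ : ∃ v : p.toSubmodule, v ≠ 0 := by
      by_contra! hcon
      obtain ⟨a, b, hab⟩ := hp.exists_pair_ne
      exact hab (Subrepresentation.toSubmodule_injective (Submodule.ext fun v => by
        simp [hcon v]))
    -- If `M` lay in the kernel, `v` would be a nonzero `M`-fixed vector of σ.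
    have hv' : (v : V) ∈ invariants (σ.comp M.subtype) := fun m => by
      have := apply_eq_one_of_subset_charKer p.toRepresentation (M.subgroupOf N) hker
        (m := ⟨m, hMN m.2⟩) (Subgroup.mem_subgroupOf.2 m.2)
      exact congrArg Subtype.val (LinearMap.congr_fun this v)
    rw [hσ.invariants_eq_bot σ M hM] at hv'
    exact hv (Subtype.ext ((Submodule.mem_bot ℂ).1 hv'))
  obtain ⟨n, π, hπ, hπχ⟩ := hind _ hψ
  -- By reciprocity, a zero sum would kill the inclusion of `p` in the restriction of σ.
  -- Nonvanishing then gives σ ≅ π.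
  have h1 : ∑ g, σ.character g⁻¹ * π.character g ≠ 0 := by
    intro h0
    have h2 := card_mul_sum_mul_inducedChar N p.toRepresentation.character
      (χ := fun g => σ.character g⁻¹) fun x g => by
        rw [mul_inv_rev, mul_inv_rev, inv_inv, ← mul_assoc, char_conj]
    rw [← hπχ, h0, mul_zero] at h2
    have h3 := sum_char_mul_char_inv_eq p.toRepresentation τ
    have h4 : ∑ h : N, τ.character h * p.toRepresentation.character h⁻¹ =
        ∑ h : N, σ.character (h : G)⁻¹ * p.toRepresentation.character h :=
      Fintype.sum_equiv (Equiv.inv N) _ _ fun h => by simp [τ, character]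
    rw [← h4, h3] at h2
    have h5 : Module.finrank ℂ (IntertwiningMap p.toRepresentation τ) = 0 := by
      simpa using h2.symm
    let f : IntertwiningMap p.toRepresentation τ := ⟨p.toSubmodule.subtype, fun _ => rfl⟩
    have h6 : f = 0 := (Module.finrank_zero_iff.1 h5).elim _ _
    obtain ⟨a, b, hab⟩ := hp.exists_pair_ne
    refine hab (Subrepresentation.toSubmodule_injective (Submodule.ext fun v => ?_))
    have hv : v = 0 := Subtype.ext (DFunLike.congr_fun h6 v)
    simp [hv]
  have : Invertible (Nat.card G : ℂ) := invertibleOfNonzero (by simp)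
  have h7 := char_orthonormal π σ
  have h8 : Nonempty (Equiv σ π) := by
    by_contra hne
    rw [if_neg hne] at h7
    refine h1 ?_
    simpa [mul_comm] using h7
  obtain ⟨e⟩ := h8
  rw [char_iso e, hπχ, inducedChar_eq_zero_of_notMem N _ hg]

/-- If `M` acts nontrivially, χ vanishes at both g and gx, which lie outside `N`; otherwise x acts
trivially. -/
theorem isIrrChar_apply_mul_eq (hMN : M ≤ N)
    (hind : ∀ ψ ∈ irrNotOver (M.subgroupOf N), IsIrrChar (inducedChar N ψ)) {χ : G → ℂ}
    (hχ : IsIrrChar χ) {g x : G} (hg : g ∉ N) (hx : x ∈ M) : χ (g * x) = χ g := by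
  obtain ⟨n, σ, hσ, rfl⟩ := hχ
  by_cases hM : ∃ m ∈ M, σ m ≠ 1
  · rw [character_eq_zero_of_notMem hMN hind σ hσ hM hg,
      character_eq_zero_of_notMem hMN hind σ hσ hM
        fun h => hg ((N.mul_mem_cancel_right (hMN hx)).1 h)]
  · push Not at hM
    simp [character, hM x hx]

/-- If no character separates `a` from `b`, then `a` has a conjugate in `⟨b⟩`. -/
theorem exists_conj_mem_zpowers {a b : G} (h : ∀ χ : G → ℂ, IsIrrChar χ → χ a = χ b) :
    ∃ x : G, x * a * x⁻¹ ∈ Subgroup.zpowers b := by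
  classical
  by_contra! hcon
  -- The permutation character on the cosets of ⟨b⟩ is nonzero at b, and zero at any element with no
  -- conjugate in ⟨b⟩.
  have h1 := character_eq_of_forall_isIrrChar
    (coind (Subgroup.zpowers b).subtype (1 : Representation ℂ (Subgroup.zpowers b) ℂ)) h
  rw [character_coind] at h1
  have h2 : ∀ z, character (1 : Representation ℂ (Subgroup.zpowers b) ℂ) z = 1 := fun z => by
    simp [character]
  simp only [inducedChar, h2] at h1
  simp only [hcon, dite_eq_ite, if_false, Finset.sum_const_zero, mul_zero] at h1
  rw [eq_comm, mul_eq_zero, Finset.sum_boole] at h1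
  have h3 := h1.resolve_left (by simp)
  rw [Nat.cast_eq_zero, Finset.card_eq_zero, Finset.filter_eq_empty_iff] at h3
  exact h3 (Finset.mem_univ 1) (by simp)

/-- Take p dividing the order of gN and m the p'-part of the order of g: g^m ∈ `N` would make that
order, hence p, divide m. -/
theorem exists_pow_notMem_of_notMem {g : G} (hg : g ∉ N) :
    ∃ p a m : ℕ, p.Prime ∧ p ∣ N.index ∧ orderOf (g ^ m) = p ^ a ∧ g ^ m ∉ N := by
  have h1 : orderOf (g : G ⧸ N) ≠ 1 := by
    rwa [ne_eq, orderOf_eq_one_iff, QuotientGroup.eq_one_iff]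
  obtain ⟨p, hp, hpd⟩ := Nat.exists_prime_and_dvd h1
  obtain ⟨a, m, hm, he⟩ := Nat.exists_eq_pow_mul_and_not_dvd (orderOf_pos g).ne' p hp.ne_one
  refine ⟨p, a, m, hp, hpd.trans (by rw [Subgroup.index]; exact orderOf_dvd_natCard _), ?_, ?_⟩
  · have hm0 : m ≠ 0 := by rintro rfl; simp at hm
    rw [orderOf_pow_of_dvd hm0 (he ▸ dvd_mul_left _ _), he,
      Nat.mul_div_cancel _ (Nat.pos_of_ne_zero hm0)]
  · intro hmem
    refine hm (hpd.trans (orderOf_dvd_of_pow_eq_one ?_))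
    rwa [← QuotientGroup.mk_pow, QuotientGroup.eq_one_iff]

theorem centralizer_le_of_isIrrChar_inducedChar (hMN : M ≤ N)
    (hcop : Nat.Coprime N.index (Nat.card M))
    (hind : ∀ ψ ∈ irrNotOver (M.subgroupOf N), IsIrrChar (inducedChar N ψ)) {x : G} (hx : x ∈ M)
    (hx1 : x ≠ 1) : Subgroup.centralizer {x} ≤ N := by
  intro g hgx
  by_contra hg
  obtain ⟨p, a, m, hp, hpN, hord, hgm⟩ := exists_pow_notMem_of_notMem hg
  have hcomm : Commute (g ^ m) x :=
    Commute.pow_left (Subgroup.mem_centralizer_singleton_iff.1 hgx) m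
  obtain ⟨y, hy⟩ := exists_conj_mem_zpowers fun χ hχ =>
    isIrrChar_apply_mul_eq hMN hind hχ hgm hx
  -- Being conjugate into ⟨g^m⟩ bounds the order of g^m x; since the factors commute, x^(p^a) = 1,
  -- while p does not divide |M|.
  have h1 : (g ^ m * x) ^ p ^ a = 1 := by
    have h2 := orderOf_dvd_iff_pow_eq_one.1 ((orderOf_dvd_of_mem_zpowers hy).trans hord.dvd)
    rwa [conj_pow, conj_eq_one_iff] at h2
  rw [hcomm.mul_pow, ← hord, pow_orderOf_eq_one, one_mul, hord] at h1
  have h3 : orderOf x ∣ Nat.card M := Subgroup.orderOf_dvd_natCard M hx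
  have h4 : Nat.Coprime (p ^ a) (Nat.card M) := (hcop.coprime_dvd_left hpN).pow_left a
  exact hx1 (orderOf_eq_one_iff.1 (Nat.eq_one_of_dvd_coprimes h4 (orderOf_dvd_of_pow_eq_one h1) h3))

end Converse

theorem theoremC {G : Type*} [Group G] [Fintype G] (N M : Subgroup G)
    (hN : N.Normal) (hM : M.Normal) (hN_bot : N ≠ ⊥) (hN_top : N ≠ ⊤)
    (hM_bot : M ≠ ⊥) (hM_top : M ≠ ⊤) (hMN : M ≤ N) :
    (IsFrobeniusTriple N M →
      ∀ ψ ∈ irrNotOver (M.subgroupOf N), IsIrrChar (inducedChar N ψ)) ∧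
    (Nat.Coprime N.index (Nat.card M) →
      (IsFrobeniusTriple N M ↔
        ∀ ψ ∈ irrNotOver (M.subgroupOf N), IsIrrChar (inducedChar N ψ))) := by
  have h : IsFrobeniusTriple N M →
      ∀ ψ ∈ irrNotOver (M.subgroupOf N), IsIrrChar (inducedChar N ψ) :=
    fun hF _ hψ => isIrrChar_inducedChar hMN hF.centralizer_le hψ
  exact ⟨h, fun hcop => ⟨h, fun hind => ⟨hN, hM, hN_bot, hN_top, hM_bot, hM_top, hMN,
    fun _ hx hx1 => centralizer_le_of_isIrrChar_inducedChar hMN hcop hind hx hx1⟩⟩⟩
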